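/- Let $R>0$ and let $L(x,v)$, $x=(x_1,x_2)\in\mathbb R^2$, $v\in\mathbb R^2$, be a Lagrangian on the tangent bundle of the plane which is $C^\infty$ for $v\ne 0$, positively homogeneous of degree $1$ in the velocity, $L(x,tv)=tL(x,v)$ for all $t>0$, and fibrewise quadratically convex, i.e. $\frac{d^2}{ds^2}\big|_{s=0}L(x,v+sw)>0$ for all $x$ and all linearly independent $v,w$. (Neither $L\ge 0$ nor $L(x,-v)=L(x,v)$ is assumed.) Suppose that the extremals of $L$ are the positively oriented circles of radius $R$: a smooth regular curve $\gamma:[t_0,t_1]\to\mathbb R^2$ is an extremal of the functional $\int_{t_0}^{t_1} L(\gamma(t),\gamma'(t))\,dt$ with fixed end points if and only if it runs counterclockwise along a circle of radius $R$. Then there are $C^\infty$ functions $g,a,b:\mathbb R^2\to\mathbb R$ such that, in polar coordinates $v=(r\cos\alpha,r\sin\alpha)$ with $r\ge 0$, $\alpha\in\mathbb R$, $$L(x,v)=r\Bigl(\int_0^{\alpha+\pi/2}\cos(\alpha-\phi)\,g(x_1+R\cos\phi,\,x_2+R\sin\phi)\,d\phi+a(x_1,x_2)\cos\alpha+b(x_1,x_2)\sin\alpha\Bigr),$$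 where $g$ is everywhere positive, for every circle of radius $R$ the center of mass of the circle with density $g$ with respect to arc length is its center, and $$\frac{\partial a}{\partial x_2}(x_1,x_2)-\frac{\partial b}{\partial x_1}(x_1,x_2)=\frac1R\,g(x_1+R,x_2)\qquad\text{for all }(x_1,x_2)\in\mathbb R^2 .$$ -/

import Mathlib

open scoped ContDiff

noncomputable section

/-- The point with polar angle `θ` on the circle of radius `R` centred at `c` in the plane. -/
def circlePoint (R : ℝ) (c : ℝ × ℝ) (θ : ℝ) : ℝ × ℝ :=
  (c.1 + R * Real.cos θ, c.2 + R * Real.sin θ)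

/-- A Lagrangian `L x v` (position `x`, velocity `v`) on the tangent bundle of the plane:
smooth off the zero section, positively homogeneous of degree 1 in the velocity, and
fibrewise quadratically convex, that is, its Hessian in the velocity variable at `v ≠ 0` is
positive in every direction transverse to `v` (along `v` it vanishes by homogeneity).
`L` need not be positive or symmetric. -/
structure IsHomogeneousLagrangian (L : ℝ × ℝ → ℝ × ℝ → ℝ) : Prop where
  smooth : ContDiffOn ℝ ∞ (fun q : (ℝ × ℝ) × (ℝ × ℝ) => L q.1 q.2) {q | q.2 ≠ 0}
  homogeneous : ∀ (x v : ℝ × ℝ) (t : ℝ), 0 < t → L x (t • v) = t * L x v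
  quadConvex : ∀ x v w : ℝ × ℝ, LinearIndependent ℝ ![v, w] →
    0 < iteratedDeriv 2 (fun s : ℝ => L x (v + s • w)) 0

/-- The functional `∫_a^b L(γ(t), γ'(t)) dt`. -/
def lagrangianLength (L : ℝ × ℝ → ℝ × ℝ → ℝ) (a b : ℝ) (γ : ℝ → ℝ × ℝ) : ℝ :=
  ∫ t in a..b, L (γ t) (deriv γ t)

/-- `γ` restricted to `[a, b]` is an extremal: the first variation of the length functional
vanishes for every smooth variation field with fixed end points. -/
def IsExtremal (L : ℝ × ℝ → ℝ × ℝ → ℝ) (a b : ℝ) (γ : ℝ → ℝ × ℝ) : Prop :=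
  ∀ η : ℝ → ℝ × ℝ, ContDiff ℝ ∞ η → η a = 0 → η b = 0 →
    HasDerivAt (fun ε : ℝ => lagrangianLength L a b (fun t => γ t + ε • η t)) 0 0

/-- `γ` restricted to `[a, b]` runs counterclockwise along a circle of radius `R`. -/
def IsPositiveCircleArc (R a b : ℝ) (γ : ℝ → ℝ × ℝ) : Prop :=
  ∃ (c : ℝ × ℝ) (θ : ℝ → ℝ), ContinuousOn θ (Set.Icc a b) ∧ StrictMonoOn θ (Set.Icc a b) ∧
    ∀ t ∈ Set.Icc a b, γ t = circlePoint R c (θ t)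

/-- The extremals of `L` are the positively oriented circles of radius `R`: a regular smooth
parametrized curve is an extremal if and only if it runs counterclockwise along such a circle. -/
def ExtremalsArePositiveCircles (L : ℝ × ℝ → ℝ × ℝ → ℝ) (R : ℝ) : Prop :=
  ∀ (a b : ℝ) (γ : ℝ → ℝ × ℝ), a < b → ContDiff ℝ ∞ γ →
    (∀ t ∈ Set.Icc a b, deriv γ t ≠ 0) →
    (IsExtremal L a b γ ↔ IsPositiveCircleArc R a b γ)

/-- The center of mass of the circle of radius `R` centred at `c` whose mass is distributed with
density `g` with respect to arc length `R dφ`. -/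
def circleCenterOfMass (g : ℝ × ℝ → ℝ) (R : ℝ) (c : ℝ × ℝ) : ℝ × ℝ :=
  (∫ φ in (0 : ℝ)..(2 * Real.pi), g (circlePoint R c φ) * R)⁻¹ •
    ∫ φ in (0 : ℝ)..(2 * Real.pi), (g (circlePoint R c φ) * R) • circlePoint R c φ

end

open scoped ContDiff

open Set Filter Topology MeasureTheory Interval

/-! Write `ℓ(x, α)` for `L` on the unit vector of angle `α` and put `h = ℓ + ℓ_αα`; convexity says
`h > 0` (`angularHessian_pos`). That circles are extremals turns the normal Euler-Lagrange equation
into a linear first-order identity for `ℓ` (`euler_lagrange`). Differentiating it in `α`, the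
surplus terms cancel and leave `R (cos α ∂₁h + sin α ∂₂h) + ∂_α h = 0`: `h` is constant along the
extremal flow. A flow line is determined by the center of its circle, so `h(x, φ - π/2) = g(x +
R(cos φ, sin φ))` (`angularHessian_circle`).

For fixed `x`, solving `ℓ + ℓ_αα = h` by variation of constants from `α = -π/2` gives the integral
formula, with initial data `a = ℓ_α` and `b = -ℓ`. Since `ℓ` is `2π`-periodic, `h` is orthogonal to
`cos` and `sin`, which is the center of mass condition. The Euler-Lagrange identity at `α = -π/2` is
the equation relating `a`, `b` and `g`. -/

/-! ### First variation and the Euler-Lagrange equation -/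

/-- Differentiation under the integral sign for an integrand that is `C¹` near the segment. -/
theorem hasDerivAt_intervalIntegral_of_contDiffOn {H : ℝ × ℝ → ℝ} {U : Set (ℝ × ℝ)}
    (hU : IsOpen U) (hH : ContDiffOn ℝ 1 H U) {a b ε₀ : ℝ} (hab : a ≤ b)
    (h0 : ∀ t ∈ Icc a b, (ε₀, t) ∈ U) :
    HasDerivAt (fun ε => ∫ t in a..b, H (ε, t)) (∫ t in a..b, fderiv ℝ H (ε₀, t) (1, 0)) ε₀ := by
  -- Compactness of `[a, b]` gives one neighbourhood of `ε₀` that works for all `t`, hence a uniform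
  -- bound on the derivative.
  obtain ⟨u, v, hu, -, hu0, hv, huv⟩ := generalized_tube_lemma (isCompact_singleton (x := ε₀))
    (isCompact_Icc (a := a) (b := b)) hU (by
      rintro ⟨x, t⟩ ⟨hx, ht⟩
      obtain rfl : x = ε₀ := hx
      exact h0 t ht)
  obtain ⟨δ, hδ, hball⟩ := Metric.isOpen_iff.1 hu ε₀ (hu0 rfl)
  have hsub : ∀ ε ∈ Metric.closedBall ε₀ (δ / 2), ∀ t ∈ Icc a b, (ε, t) ∈ U := fun ε hε t ht =>
    huv ⟨hball (Metric.closedBall_subset_ball (by linarith) hε), hv ht⟩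
  have hd : ContinuousOn (fun p => fderiv ℝ H p (1, 0)) U :=
    (hH.continuousOn_fderiv_of_isOpen hU le_rfl).clm_apply continuousOn_const
  obtain ⟨C, hC⟩ := ((isCompact_closedBall ε₀ (δ / 2)).prod
    (isCompact_Icc (a := a) (b := b))).exists_bound_of_continuousOn
      (hd.mono fun p hp => hsub _ hp.1 _ hp.2)
  have hs : Metric.closedBall ε₀ (δ / 2) ∈ 𝓝 ε₀ := Metric.closedBall_mem_nhds _ (by linarith)
  have hΙ : Ι a b ⊆ Icc a b := by rw [uIoc_of_le hab]; exact Ioc_subset_Icc_self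
  have hcont : ∀ ε ∈ Metric.closedBall ε₀ (δ / 2), ContinuousOn (fun t => H (ε, t)) (Icc a b) :=
    fun ε hε => hH.continuousOn.comp (by fun_prop) fun t ht => hsub ε hε t ht
  have hmem : ε₀ ∈ Metric.closedBall ε₀ (δ / 2) := mem_of_mem_nhds hs
  refine (intervalIntegral.hasDerivAt_integral_of_dominated_loc_of_deriv_le
    (F := fun ε t => H (ε, t)) (F' := fun ε t => fderiv ℝ H (ε, t) (1, 0)) (bound := fun _ => C)
    hs ?_ ?_ ?_ ?_ ?_ ?_).2
  · filter_upwards [hs] with ε hε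
    exact ((hcont ε hε).mono hΙ).aestronglyMeasurable measurableSet_uIoc
  · exact ContinuousOn.intervalIntegrable (by rw [uIcc_of_le hab]; exact hcont ε₀ hmem)
  · refine ContinuousOn.aestronglyMeasurable ?_ measurableSet_uIoc
    exact hd.comp (by fun_prop) fun t ht => hsub ε₀ hmem t (hΙ ht)
  · exact Eventually.of_forall fun t ht ε hε => hC (ε, t) ⟨hε, hΙ ht⟩
  · exact intervalIntegrable_const
  · refine Eventually.of_forall fun t ht ε hε => ?_
    have h1 : HasFDerivAt H (fderiv ℝ H (ε, t)) (ε, t) :=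
      ((hH.differentiableOn one_ne_zero).differentiableAt
        (hU.mem_nhds (hsub ε hε t (hΙ ht)))).hasFDerivAt
    exact h1.comp_hasDerivAt ε ((hasDerivAt_id ε).prodMk (hasDerivAt_const ε t))

/-- The Euler-Lagrange equation of an extremal. -/
theorem IsExtremal.hasDerivAt_momentum {L : ℝ × ℝ → ℝ × ℝ → ℝ} (hL : IsHomogeneousLagrangian L)
    {a b : ℝ} {γ : ℝ → ℝ × ℝ} (hab : a < b) (hγ : ContDiff ℝ ∞ γ) (hreg : ∀ t, deriv γ t ≠ 0)
    (hext : IsExtremal L a b γ) (w : ℝ × ℝ) {t : ℝ} (ht : t ∈ Ioo a b) :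
    HasDerivAt (fun t => fderiv ℝ (fun q : (ℝ × ℝ) × (ℝ × ℝ) => L q.1 q.2) (γ t, deriv γ t) (0, w))
      (fderiv ℝ (fun q : (ℝ × ℝ) × (ℝ × ℝ) => L q.1 q.2) (γ t, deriv γ t) (w, 0)) t := by
  set G : (ℝ × ℝ) × (ℝ × ℝ) → ℝ := fun q => L q.1 q.2 with hG
  have hV : IsOpen {q : (ℝ × ℝ) × (ℝ × ℝ) | q.2 ≠ 0} :=
    isOpen_ne.preimage continuous_snd
  have hγ' : ContDiff ℝ ∞ (deriv γ) := (contDiff_infty_iff_deriv.1 hγ).2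
  have hDG : ContDiffOn ℝ ∞ (fderiv ℝ G) {q | q.2 ≠ 0} := hL.smooth.fderiv_of_isOpen hV (by simp)
  have hcomp : ContDiff ℝ ∞ (fun t => fderiv ℝ G (γ t, deriv γ t)) :=
    contDiffOn_univ.1 (hDG.comp (hγ.prodMk hγ').contDiffOn fun t _ => hreg t)
  set A : ℝ → ℝ := fun t => fderiv ℝ G (γ t, deriv γ t) (w, 0) with hA
  set B : ℝ → ℝ := fun t => fderiv ℝ G (γ t, deriv γ t) (0, w) with hB
  have hAc : ContDiff ℝ ∞ A := hcomp.clm_apply contDiff_const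
  have hBc : ContDiff ℝ ∞ B := hcomp.clm_apply contDiff_const
  have hB' : Continuous (deriv B) := (contDiff_infty_iff_deriv.1 hBc).2.continuous
  have hBd : Differentiable ℝ B := (contDiff_infty_iff_deriv.1 hBc).1
  have key : ∀ ψ : ℝ → ℝ, ContDiff ℝ ∞ ψ → ψ a = 0 → ψ b = 0 →
      ∫ t in a..b, ψ t * (A t - deriv B t) = 0 := by
    intro ψ hψ ha hb
    have hψ' : ContDiff ℝ ∞ (deriv ψ) := (contDiff_infty_iff_deriv.1 hψ).2
    have hψd : Differentiable ℝ ψ := (contDiff_infty_iff_deriv.1 hψ).1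
    -- Position and velocity of the curve varied by `ε ψ w`. The integrand `G ∘ K` is known to be
    -- smooth only where the velocity is nonzero, which includes all of `ε = 0`.
    set K : ℝ × ℝ → (ℝ × ℝ) × (ℝ × ℝ) := fun p =>
      (γ p.2 + p.1 • ψ p.2 • w, deriv γ p.2 + p.1 • deriv ψ p.2 • w) with hK
    have hKc : ContDiff ℝ ∞ K := by
      rw [hK]; fun_prop
    have hU : IsOpen {p | (K p).2 ≠ 0} := hV.preimage hKc.continuous
    have h1 := hasDerivAt_intervalIntegral_of_contDiffOn (H := G ∘ K) (ε₀ := 0) hU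
      ((hL.smooth.comp hKc.contDiffOn fun p hp => hp).of_le (by simp)) hab.le
      (fun t _ => by simpa [hK] using hreg t)
    have h2 := hext (fun t => ψ t • w) (by fun_prop) (by simp [ha]) (by simp [hb])
    have h3 : (fun ε : ℝ => lagrangianLength L a b (fun t => γ t + ε • ψ t • w))
        = fun ε => ∫ t in a..b, (G ∘ K) (ε, t) := by
      funext ε
      refine intervalIntegral.integral_congr fun t _ => ?_
      have : deriv (fun t => γ t + ε • ψ t • w) t = deriv γ t + ε • deriv ψ t • w :=
        (((contDiff_infty_iff_deriv.1 hγ).1 t).hasDerivAt.add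
          (((hψd t).hasDerivAt.smul_const w).const_smul ε)).deriv
      simp [hK, hG, this]
    rw [h3] at h2
    have h4 : ∀ t, fderiv ℝ (G ∘ K) (0, t) (1, 0) = ψ t * A t + deriv ψ t * B t := by
      intro t
      have hGd : HasFDerivAt G (fderiv ℝ G (γ t, deriv γ t)) (K ((fun ε : ℝ => (ε, t)) 0)) := by
        have : K (0, t) = (γ t, deriv γ t) := by simp [hK]
        rw [this]
        exact ((hL.smooth.differentiableOn (by simp)).differentiableAt
          (hV.mem_nhds (hreg t))).hasFDerivAt
      have hcurve : HasDerivAt (fun ε : ℝ => K (ε, t)) (ψ t • w, deriv ψ t • w) 0 := by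
        have e1 : HasDerivAt (fun ε : ℝ => γ t + ε • ψ t • w) (ψ t • w) 0 := by
          simpa using ((hasDerivAt_id (0 : ℝ)).smul_const (ψ t • w)).const_add (γ t)
        have e2 : HasDerivAt (fun ε : ℝ => deriv γ t + ε • deriv ψ t • w) (deriv ψ t • w) 0 := by
          simpa using ((hasDerivAt_id (0 : ℝ)).smul_const (deriv ψ t • w)).const_add (deriv γ t)
        exact e1.prodMk e2
      have hGK : HasFDerivAt (G ∘ K) (fderiv ℝ (G ∘ K) (0, t)) (0, t) := by
        refine DifferentiableAt.hasFDerivAt ?_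
        exact hGd.differentiableAt.comp (0, t) (hKc.differentiable (by simp) _)
      have e3 := hGK.comp_hasDerivAt (0 : ℝ)
        ((hasDerivAt_id (0 : ℝ)).prodMk (hasDerivAt_const (0 : ℝ) t))
      have e4 := hGd.comp_hasDerivAt (0 : ℝ) hcurve
      have e5 := e3.unique e4
      rw [e5, show ((ψ t • w, deriv ψ t • w) : (ℝ × ℝ) × (ℝ × ℝ))
        = ψ t • ((w, 0) : (ℝ × ℝ) × (ℝ × ℝ)) + deriv ψ t • ((0, w) : (ℝ × ℝ) × (ℝ × ℝ)) by simp,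
        map_add, map_smul, map_smul]
      rfl
    have h5 := h1.unique h2
    simp only [h4] at h5
    have i1 : IntervalIntegrable (fun t => ψ t * A t) volume a b :=
      (hψ.continuous.mul hAc.continuous).intervalIntegrable _ _
    have i2 : IntervalIntegrable (fun t => deriv ψ t * B t) volume a b :=
      (hψ'.continuous.mul hBc.continuous).intervalIntegrable _ _
    have i3 : IntervalIntegrable (fun t => ψ t * deriv B t) volume a b :=
      (hψ.continuous.mul hB').intervalIntegrable _ _
    have h6 := intervalIntegral.integral_mul_deriv_eq_deriv_mul
      (fun t (_ : t ∈ uIcc a b) => (hψd t).hasDerivAt) (fun t _ => (hBd t).hasDerivAt)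
      (hψ'.continuous.intervalIntegrable _ _) (hB'.intervalIntegrable _ _)
    rw [intervalIntegral.integral_add i1 i2] at h5
    simp only [mul_sub]
    rw [intervalIntegral.integral_sub i1 i3]
    rw [ha, hb] at h6
    linarith
  have hfc : Continuous (fun t => A t - deriv B t) := hAc.continuous.sub hB'
  -- Fundamental lemma of the calculus of variations; continuity then upgrades almost everywhere to
  -- everywhere on the open interval.
  have hae := isOpen_Ioo.ae_eq_zero_of_integral_contDiff_smul_eq_zero (U := Ioo a b) (μ := volume)
    (hfc.locallyIntegrable.locallyIntegrableOn (Ioo a b)) (by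
      intro ψ hψ _ hsupp
      have hz : ∀ t, t ∉ Ioo a b → ψ t = 0 := fun t ht =>
        image_eq_zero_of_notMem_tsupport fun h => ht (hsupp h)
      rw [← key ψ hψ (hz a (by simp)) (hz b (by simp)), intervalIntegral.integral_of_le hab.le,
        setIntegral_eq_integral_of_forall_compl_eq_zero]
      · rfl
      · intro t ht
        rw [hz t fun h => ht (Ioo_subset_Ioc_self h), zero_mul])
  have heq : EqOn (fun t => A t - deriv B t) 0 (Ioo a b) :=
    Measure.eqOn_open_of_ae_eq ((ae_restrict_iff' measurableSet_Ioo).2 hae) isOpen_Ioo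
      hfc.continuousOn continuousOn_const
  have : A t = deriv B t := sub_eq_zero.1 (heq ht)
  change HasDerivAt B (A t) t
  rw [this]
  exact (hBd t).hasDerivAt

/-! ### Derivatives in position and angle -/

/-- The derivative of `f` in the constant direction `u`. -/
noncomputable def dirDeriv {E : Type*} [NormedAddCommGroup E] [NormedSpace ℝ E] (u : E)
    (f : E → ℝ) : E → ℝ :=
  fun p => fderiv ℝ f p u

section DirDeriv

variable {E : Type*} [NormedAddCommGroup E] [NormedSpace ℝ E]

theorem ContDiff.dirDeriv {f : E → ℝ} (hf : ContDiff ℝ ∞ f) (u : E) :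
    ContDiff ℝ ∞ (dirDeriv u f) :=
  (hf.fderiv_right (by simp)).clm_apply contDiff_const

theorem dirDeriv_comm {f : E → ℝ} (hf : ContDiff ℝ ∞ f) (u w : E) :
    dirDeriv u (dirDeriv w f) = dirDeriv w (dirDeriv u f) := by
  have hd : Differentiable ℝ (fderiv ℝ f) :=
    (hf.fderiv_right (m := 1) (by norm_cast)).differentiable one_ne_zero
  have h : ∀ (u w p : E), dirDeriv u (dirDeriv w f) p = fderiv ℝ (fderiv ℝ f) p u w := by
    intro u w p
    have := (hd p).hasFDerivAt.clm_apply (hasFDerivAt_const w p)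
    change fderiv ℝ (fun q => fderiv ℝ f q w) p u = _
    rw [this.fderiv]
    simp
  funext p
  rw [h, h]
  exact (hf.contDiffAt.isSymmSndFDerivAt (by
    rw [minSmoothness_of_isRCLikeNormedField]; norm_cast)) u w

end DirDeriv

/-- The derivative of a function of position and angle along a curve. -/
theorem hasDerivAt_comp_curve {f : (ℝ × ℝ) × ℝ → ℝ} (hf : ContDiff ℝ ∞ f)
    {x₁ x₂ θ : ℝ → ℝ} {x₁' x₂' θ' t : ℝ} (h₁ : HasDerivAt x₁ x₁' t) (h₂ : HasDerivAt x₂ x₂' t)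
    (hθ : HasDerivAt θ θ' t) :
    HasDerivAt (fun s => f ((x₁ s, x₂ s), θ s))
      (x₁' * dirDeriv ((1, 0), 0) f ((x₁ t, x₂ t), θ t)
        + x₂' * dirDeriv ((0, 1), 0) f ((x₁ t, x₂ t), θ t)
        + θ' * dirDeriv (0, 1) f ((x₁ t, x₂ t), θ t)) t := by
  have hfd : HasFDerivAt f (fderiv ℝ f ((x₁ t, x₂ t), θ t)) ((x₁ t, x₂ t), θ t) :=
    (hf.differentiable (by simp) _).hasFDerivAt
  have := hfd.comp_hasDerivAt t ((h₁.prodMk h₂).prodMk hθ)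
  rw [show ((x₁', x₂'), θ') = x₁' • (((1, 0), 0) : (ℝ × ℝ) × ℝ) + x₂' • (((0, 1), 0) : (ℝ × ℝ) × ℝ)
    + θ' • ((0, 1) : (ℝ × ℝ) × ℝ) by simp, map_add, map_add, map_smul, map_smul, map_smul] at this
  exact this

theorem hasDerivAt_angle {f : (ℝ × ℝ) × ℝ → ℝ} (hf : ContDiff ℝ ∞ f) (x : ℝ × ℝ) (α : ℝ) :
    HasDerivAt (fun s => f (x, s)) (dirDeriv (0, 1) f (x, α)) α := by
  simpa using hasDerivAt_comp_curve hf (hasDerivAt_const α x.1) (hasDerivAt_const α x.2)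
    (hasDerivAt_id α)

/-! ### The Lagrangian in polar coordinates -/

/-- The restriction of a Lagrangian to unit vectors, as a function of position and angle. -/
noncomputable def angular (L : ℝ × ℝ → ℝ × ℝ → ℝ) : (ℝ × ℝ) × ℝ → ℝ :=
  fun p => L p.1 (Real.cos p.2, Real.sin p.2)

/-- The radius of curvature `ℓ + ∂²ℓ/∂α²` of the angular function `ℓ` of a Lagrangian. -/
noncomputable def angularHessian (L : ℝ × ℝ → ℝ × ℝ → ℝ) : (ℝ × ℝ) × ℝ → ℝ :=
  fun p => angular L p + dirDeriv (0, 1) (dirDeriv (0, 1) (angular L)) p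

theorem cos_sin_ne_zero (α : ℝ) : ((Real.cos α, Real.sin α) : ℝ × ℝ) ≠ 0 := by
  intro h
  have h1 := congrArg Prod.fst h
  have h2 := congrArg Prod.snd h
  have := Real.sin_sq_add_cos_sq α
  simp_all

namespace IsHomogeneousLagrangian

variable {L : ℝ × ℝ → ℝ × ℝ → ℝ}

theorem contDiff_angular (hL : IsHomogeneousLagrangian L) : ContDiff ℝ ∞ (angular L) := by
  have h : ContDiff ℝ ∞ (fun p : (ℝ × ℝ) × ℝ => (p.1, (Real.cos p.2, Real.sin p.2))) :=
    contDiff_fst.prodMk ((Real.contDiff_cos.comp contDiff_snd).prodMk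
      (Real.contDiff_sin.comp contDiff_snd))
  exact contDiffOn_univ.1 (hL.smooth.comp h.contDiffOn fun p _ => cos_sin_ne_zero p.2)

theorem contDiff_angularHessian (hL : IsHomogeneousLagrangian L) :
    ContDiff ℝ ∞ (angularHessian L) :=
  hL.contDiff_angular.add ((hL.contDiff_angular.dirDeriv _).dirDeriv _)

theorem hasFDerivAt_unit (hL : IsHomogeneousLagrangian L) (x : ℝ × ℝ) (α : ℝ) :
    HasFDerivAt (fun q : (ℝ × ℝ) × (ℝ × ℝ) => L q.1 q.2)
      (fderiv ℝ (fun q : (ℝ × ℝ) × (ℝ × ℝ) => L q.1 q.2) (x, (Real.cos α, Real.sin α)))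
      (x, (Real.cos α, Real.sin α)) :=
  ((hL.smooth.differentiableOn (by simp)).differentiableAt
    ((isOpen_ne.preimage continuous_snd).mem_nhds (cos_sin_ne_zero α))).hasFDerivAt

/-- Derivative of the Lagrangian in the position. -/
theorem fderiv_position (hL : IsHomogeneousLagrangian L) (x : ℝ × ℝ) (α : ℝ) (w : ℝ × ℝ) :
    fderiv ℝ (fun q : (ℝ × ℝ) × (ℝ × ℝ) => L q.1 q.2) (x, (Real.cos α, Real.sin α)) (w, 0)
      = w.1 * dirDeriv ((1, 0), 0) (angular L) (x, α)
        + w.2 * dirDeriv ((0, 1), 0) (angular L) (x, α) := by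
  have h₁ : HasDerivAt (fun s : ℝ => x.1 + s * w.1) w.1 0 := by
    simpa using ((hasDerivAt_id (0 : ℝ)).mul_const w.1).const_add x.1
  have h₂ : HasDerivAt (fun s : ℝ => x.2 + s * w.2) w.2 0 := by
    simpa using ((hasDerivAt_id (0 : ℝ)).mul_const w.2).const_add x.2
  have e1 := hasDerivAt_comp_curve hL.contDiff_angular h₁ h₂ (hasDerivAt_const (0 : ℝ) α)
  have hx : (x.1 + 0 * w.1, x.2 + 0 * w.2) = x := by simp
  have hfd := hL.hasFDerivAt_unit x α
  have hfd' : HasFDerivAt (fun q : (ℝ × ℝ) × (ℝ × ℝ) => L q.1 q.2)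
      (fderiv ℝ (fun q : (ℝ × ℝ) × (ℝ × ℝ) => L q.1 q.2) (x, (Real.cos α, Real.sin α)))
      ((fun s : ℝ => ((x.1 + s * w.1, x.2 + s * w.2), (Real.cos α, Real.sin α))) 0) := by
    simpa using hfd
  have e2 := hfd'.comp_hasDerivAt (0 : ℝ) ((h₁.prodMk h₂).prodMk
    (hasDerivAt_const (0 : ℝ) ((Real.cos α, Real.sin α) : ℝ × ℝ)))
  have := e2.unique e1
  simpa [hx] using this

/-- Derivative of the Lagrangian in the velocity, in polar coordinates. -/
theorem fderiv_velocity (hL : IsHomogeneousLagrangian L) (x : ℝ × ℝ) (α : ℝ) (w : ℝ × ℝ) :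
    fderiv ℝ (fun q : (ℝ × ℝ) × (ℝ × ℝ) => L q.1 q.2) (x, (Real.cos α, Real.sin α)) (0, w)
      = angular L (x, α) * (Real.cos α * w.1 + Real.sin α * w.2)
        + dirDeriv (0, 1) (angular L) (x, α) * (-Real.sin α * w.1 + Real.cos α * w.2) := by
  have hfd := hL.hasFDerivAt_unit x α
  set D := fderiv ℝ (fun q : (ℝ × ℝ) × (ℝ × ℝ) => L q.1 q.2) (x, (Real.cos α, Real.sin α))
  -- Euler's identity for functions homogeneous of degree 1.
  have radial : D (0, (Real.cos α, Real.sin α)) = angular L (x, α) := by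
    have hc : HasDerivAt (fun s : ℝ => s • ((Real.cos α, Real.sin α) : ℝ × ℝ))
        (Real.cos α, Real.sin α) 1 := by
      simpa using (hasDerivAt_id (1 : ℝ)).smul_const ((Real.cos α, Real.sin α) : ℝ × ℝ)
    have hfd' : HasFDerivAt (fun q : (ℝ × ℝ) × (ℝ × ℝ) => L q.1 q.2) D
        ((fun s : ℝ => (x, s • ((Real.cos α, Real.sin α) : ℝ × ℝ))) 1) := by
      simpa using hfd
    have e1 := hfd'.comp_hasDerivAt (1 : ℝ) ((hasDerivAt_const (1 : ℝ) x).prodMk hc)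
    have e2 : HasDerivAt (fun s : ℝ => s * L x (Real.cos α, Real.sin α))
        (L x (Real.cos α, Real.sin α)) 1 := by
      simpa using (hasDerivAt_id (1 : ℝ)).mul_const (L x (Real.cos α, Real.sin α))
    refine e1.unique (e2.congr_of_eventuallyEq ?_)
    filter_upwards [lt_mem_nhds (one_pos : (0 : ℝ) < 1)] with s hs
    exact hL.homogeneous x _ s hs
  have angle : D (0, (-Real.sin α, Real.cos α)) = dirDeriv (0, 1) (angular L) (x, α) := by
    have e1 := hfd.comp_hasDerivAt α ((hasDerivAt_const α x).prodMk
      ((Real.hasDerivAt_cos α).prodMk (Real.hasDerivAt_sin α)))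
    exact e1.unique (hasDerivAt_angle hL.contDiff_angular x α)
  have hw : ((0, w) : (ℝ × ℝ) × (ℝ × ℝ))
      = (Real.cos α * w.1 + Real.sin α * w.2) • (0, (Real.cos α, Real.sin α))
        + (-Real.sin α * w.1 + Real.cos α * w.2) • (0, (-Real.sin α, Real.cos α)) := by
    have := Real.sin_sq_add_cos_sq α
    ext
    · simp
    · simp
    · simp; linear_combination -w.1 * this
    · simp; linear_combination -w.2 * this
  rw [hw, map_add, map_smul, map_smul, radial, angle, smul_eq_mul, smul_eq_mul]
  ring

/-- Fibrewise convexity in polar coordinates. -/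
theorem angularHessian_pos (hL : IsHomogeneousLagrangian L) (p : (ℝ × ℝ) × ℝ) :
    0 < angularHessian L p := by
  obtain ⟨x, α⟩ := p
  have hsc := Real.sin_sq_add_cos_sq α
  have hlin : LinearIndependent ℝ ![((Real.cos α, Real.sin α) : ℝ × ℝ),
      (-Real.sin α, Real.cos α)] := by
    rw [LinearIndependent.pair_iff]
    intro s t h
    have h1 := congrArg Prod.fst h
    have h2 := congrArg Prod.snd h
    simp at h1 h2
    constructor
    · linear_combination Real.cos α * h1 + Real.sin α * h2 - s * hsc
    · linear_combination -Real.sin α * h1 + Real.cos α * h2 - t * hsc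
  have hpos := hL.quadConvex x _ _ hlin
  -- The vector `v + s w`, with `v, w` orthonormal, has length `√(1 + s²)` and angle `α + arctan s`.
  have hf : (fun s : ℝ => L x ((Real.cos α, Real.sin α) + s • (-Real.sin α, Real.cos α)))
      = fun s => √(1 + s ^ 2) * angular L (x, α + Real.arctan s) := by
    funext s
    have h0 : 0 < √(1 + s ^ 2) := Real.sqrt_pos.2 (by positivity)
    rw [angular, ← hL.homogeneous x _ _ h0]
    congr 1
    simp only [Real.cos_add, Real.sin_add, Real.cos_arctan, Real.sin_arctan]
    ext <;> simp <;> field_simp <;> ring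
  have hℓ := hL.contDiff_angular
  have hsq : ∀ s : ℝ, HasDerivAt (fun s : ℝ => √(1 + s ^ 2)) (s / √(1 + s ^ 2)) s := by
    intro s
    refine (((hasDerivAt_pow 2 s).const_add 1).sqrt (by positivity)).congr_deriv ?_
    push_cast
    ring
  have harc : ∀ {f : (ℝ × ℝ) × ℝ → ℝ}, ContDiff ℝ ∞ f → ∀ s : ℝ,
      HasDerivAt (fun s => f (x, α + Real.arctan s))
        (dirDeriv (0, 1) f (x, α + Real.arctan s) * (1 / (1 + s ^ 2))) s := fun {f} hf s =>
    HasDerivAt.comp (h₂ := fun s => f (x, s)) s (hasDerivAt_angle hf x (α + Real.arctan s)) ((Real.hasDerivAt_arctan s).const_add α)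
  have hd1 : deriv (fun s => √(1 + s ^ 2) * angular L (x, α + Real.arctan s))
      = fun s => (s * angular L (x, α + Real.arctan s)
          + dirDeriv (0, 1) (angular L) (x, α + Real.arctan s)) / √(1 + s ^ 2) := by
    funext s
    refine ((hsq s).mul (harc hℓ s)).deriv.trans ?_
    have h0 : 0 < √(1 + s ^ 2) := Real.sqrt_pos.2 (by positivity)
    have h1 : 1 / (1 + s ^ 2) = 1 / √(1 + s ^ 2) ^ 2 := by rw [Real.sq_sqrt (by positivity)]
    rw [h1]
    generalize √(1 + s ^ 2) = r at h0
    field_simp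
  have hd2 := ((((hasDerivAt_id (0 : ℝ)).mul (harc hℓ 0)).add
    (harc (hℓ.dirDeriv (0, 1)) 0)).div (hsq 0) (by simp)).deriv
  rw [hf, iteratedDeriv_succ, iteratedDeriv_one, hd1] at hpos
  have : deriv (fun s => (s * angular L (x, α + Real.arctan s)
          + dirDeriv (0, 1) (angular L) (x, α + Real.arctan s)) / √(1 + s ^ 2)) 0
      = angularHessian L (x, α) := by
    refine hd2.trans ?_
    simp [angularHessian]
  rwa [this] at hpos

/-- The Euler-Lagrange equation in polar coordinates: the extremal through `x` in direction `α`
is the positively oriented circle of radius `R`. -/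
theorem euler_lagrange (hL : IsHomogeneousLagrangian L) {R : ℝ} (hR : 0 < R)
    (hcirc : ExtremalsArePositiveCircles L R) (x : ℝ × ℝ) (α : ℝ) :
    angularHessian L (x, α)
      + R * (Real.cos α * dirDeriv ((1, 0), 0) (dirDeriv (0, 1) (angular L)) (x, α)
        + Real.sin α * dirDeriv ((0, 1), 0) (dirDeriv (0, 1) (angular L)) (x, α)
        + Real.sin α * dirDeriv ((1, 0), 0) (angular L) (x, α)
        - Real.cos α * dirDeriv ((0, 1), 0) (angular L) (x, α)) = 0 := by
  -- Arc length parametrization of the circle, with velocity of angle `t / R`, so that `x` is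
  -- reached at `t = R * α` in direction `α`.
  set x₁ : ℝ → ℝ := fun t => x.1 + R * (Real.sin (t / R) - Real.sin α) with hx₁
  set x₂ : ℝ → ℝ := fun t => x.2 + R * (Real.cos α - Real.cos (t / R)) with hx₂
  have hdiv : ∀ t : ℝ, HasDerivAt (fun t : ℝ => t / R) (1 / R) t := fun t =>
    (hasDerivAt_id t).div_const R
  have h₁ : ∀ t, HasDerivAt x₁ (Real.cos (t / R)) t := by
    intro t
    refine ((((hdiv t).sin.sub_const (Real.sin α)).const_mul R).const_add x.1).congr_deriv ?_
    field_simp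
  have h₂ : ∀ t, HasDerivAt x₂ (Real.sin (t / R)) t := by
    intro t
    refine ((((hdiv t).cos.const_sub (Real.cos α)).const_mul R).const_add x.2).congr_deriv ?_
    field_simp
  have hγ' : deriv (fun t => (x₁ t, x₂ t)) = fun t => (Real.cos (t / R), Real.sin (t / R)) :=
    funext fun t => ((h₁ t).prodMk (h₂ t)).deriv
  have hγ : ContDiff ℝ ∞ (fun t => (x₁ t, x₂ t)) := by
    have hd : ContDiff ℝ ∞ (fun t : ℝ => t / R) := contDiff_id.div_const R
    refine ContDiff.prodMk ?_ ?_
    · exact contDiff_const.add (contDiff_const.mul ((Real.contDiff_sin.comp hd).sub contDiff_const))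
    · exact contDiff_const.add (contDiff_const.mul (contDiff_const.sub (Real.contDiff_cos.comp hd)))
  have hreg : ∀ t, deriv (fun t => (x₁ t, x₂ t)) t ≠ 0 := fun t => by
    rw [hγ']; exact cos_sin_ne_zero _
  have hext := (hcirc (R * α - 1) (R * α + 1) (fun t => (x₁ t, x₂ t)) (by linarith) hγ
    (fun t _ => hreg t)).2
    ⟨(x.1 - R * Real.sin α, x.2 + R * Real.cos α), fun t => t / R - Real.pi / 2, by fun_prop,
      fun s _ t _ hst => by
        have : s / R < t / R := by gcongr
        simpa using this,
      fun t _ => by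
        simp only [circlePoint, Real.cos_sub_pi_div_two, Real.sin_sub_pi_div_two, hx₁, hx₂]
        ext <;> simp <;> ring⟩
  -- The test vector is the normal at `x`, held constant in `t`; the tangential equation carries no
  -- information, by homogeneity.
  have hEL := hext.hasDerivAt_momentum hL (by linarith) hγ hreg (-Real.sin α, Real.cos α)
    (t := R * α) ⟨by linarith, by linarith⟩
  simp only [hγ', hL.fderiv_velocity, hL.fderiv_position] at hEL
  have hℓ := hL.contDiff_angular
  have e1 := hasDerivAt_comp_curve hℓ (h₁ (R * α)) (h₂ (R * α)) (hdiv (R * α))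
  have e2 := hasDerivAt_comp_curve (hℓ.dirDeriv (0, 1)) (h₁ (R * α)) (h₂ (R * α)) (hdiv (R * α))
  have hc := (hdiv (R * α)).cos
  have hs := (hdiv (R * α)).sin
  have e3 := (e1.mul ((hc.mul_const (-Real.sin α)).add (hs.mul_const (Real.cos α)))).add
    (e2.mul ((hs.neg.mul_const (-Real.sin α)).add (hc.mul_const (Real.cos α))))
  have e4 := hEL.unique e3
  have hRα : R * α / R = α := by field_simp
  have hx : (x₁ (R * α), x₂ (R * α)) = x := by simp [hx₁, hx₂, hRα]
  simp only [Pi.add_apply, Pi.neg_apply, hRα, hx] at e4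
  have hsc := Real.sin_sq_add_cos_sq α
  rw [angularHessian]
  field_simp at e4
  linear_combination -e4 - (angular L (x, α) + dirDeriv (0, 1) (dirDeriv (0, 1) (angular L)) (x, α)
    + R * (Real.cos α * dirDeriv ((1, 0), 0) (dirDeriv (0, 1) (angular L)) (x, α)
      + Real.sin α * dirDeriv ((0, 1), 0) (dirDeriv (0, 1) (angular L)) (x, α))) * hsc

end IsHomogeneousLagrangian

/-! ### Invariance under the extremal flow and variation of constants -/

namespace IsHomogeneousLagrangian

variable {L : ℝ × ℝ → ℝ × ℝ → ℝ}

theorem dirDeriv_angularHessian (hL : IsHomogeneousLagrangian L) (u p : (ℝ × ℝ) × ℝ) :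
    dirDeriv u (angularHessian L) p = dirDeriv u (angular L) p
      + dirDeriv u (dirDeriv (0, 1) (dirDeriv (0, 1) (angular L))) p := by
  have h1 : DifferentiableAt ℝ (angular L) p := hL.contDiff_angular.differentiable (by simp) p
  have h2 : DifferentiableAt ℝ (dirDeriv (0, 1) (dirDeriv (0, 1) (angular L))) p :=
    ((hL.contDiff_angular.dirDeriv _).dirDeriv _).differentiable (by simp) p
  exact congrArg (fun D => D u) (h1.hasFDerivAt.add h2.hasFDerivAt).fderiv

/-- The radius of curvature of the angular function is invariant under the extremal flow,
in infinitesimal form. -/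
theorem dirDeriv_angularHessian_flow (hL : IsHomogeneousLagrangian L) {R : ℝ} (hR : 0 < R)
    (hcirc : ExtremalsArePositiveCircles L R) (x : ℝ × ℝ) (α : ℝ) :
    R * Real.cos α * dirDeriv ((1, 0), 0) (angularHessian L) (x, α)
      + R * Real.sin α * dirDeriv ((0, 1), 0) (angularHessian L) (x, α)
      + dirDeriv (0, 1) (angularHessian L) (x, α) = 0 := by
  have hℓ := hL.contDiff_angular
  have hℓ' := hℓ.dirDeriv (0, 1)
  have hc := Real.hasDerivAt_cos α
  have hs := Real.hasDerivAt_sin α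
  -- The Euler-Lagrange identity is differentiated in `α`. After mixed derivatives are commuted, the
  -- terms in `∂₁ℓ_α` and `∂₂ℓ_α` cancel and the others combine into derivatives of `ℓ + ℓ_αα`.
  have hd := (hasDerivAt_angle hL.contDiff_angularHessian x α).add
    ((((hc.mul (hasDerivAt_angle (hℓ'.dirDeriv ((1, 0), 0)) x α)).add
      (hs.mul (hasDerivAt_angle (hℓ'.dirDeriv ((0, 1), 0)) x α))).add
      (hs.mul (hasDerivAt_angle (hℓ.dirDeriv ((1, 0), 0)) x α))).sub
      (hc.mul (hasDerivAt_angle (hℓ.dirDeriv ((0, 1), 0)) x α)) |>.const_mul R)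
  have h0 := hd.unique ((hasDerivAt_const α (0 : ℝ)).congr_of_eventuallyEq
    (Eventually.of_forall fun β => hL.euler_lagrange hR hcirc x β))
  simp only [hL.dirDeriv_angularHessian, dirDeriv_comm hℓ' (0, 1) ((1, 0), 0),
    dirDeriv_comm hℓ' (0, 1) ((0, 1), 0), dirDeriv_comm hℓ (0, 1) ((1, 0), 0),
    dirDeriv_comm hℓ (0, 1) ((0, 1), 0)] at h0 ⊢
  linear_combination h0

/-- The radius of curvature of the angular function depends only on the center of the extremal
circle. -/
theorem angularHessian_circle (hL : IsHomogeneousLagrangian L) {R : ℝ} (hR : 0 < R)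
    (hcirc : ExtremalsArePositiveCircles L R) (x₁ x₂ φ : ℝ) :
    angularHessian L ((x₁, x₂), φ - Real.pi / 2)
      = angularHessian L ((x₁ + R * Real.cos φ, x₂ + R * Real.sin φ - R), 0) := by
  set c₁ := x₁ + R * Real.cos φ
  set c₂ := x₂ + R * Real.sin φ
  -- On the circle about `(c₁, c₂)` the point with direction `s` is `(c₁ + R sin s, c₂ - R cos s)`;
  -- the values `s = φ - π/2` and `s = 0` are compared.
  have hd : ∀ s, HasDerivAt
      (fun s => angularHessian L ((c₁ + R * Real.sin s, c₂ - R * Real.cos s), s)) 0 s := by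
    intro s
    have h₁ : HasDerivAt (fun s => c₁ + R * Real.sin s) (R * Real.cos s) s :=
      ((Real.hasDerivAt_sin s).const_mul R).const_add c₁
    have h₂ : HasDerivAt (fun s => c₂ - R * Real.cos s) (R * Real.sin s) s :=
      (((Real.hasDerivAt_cos s).const_mul R).const_sub c₂).congr_deriv (by ring)
    refine (hasDerivAt_comp_curve hL.contDiff_angularHessian h₁ h₂ (hasDerivAt_id s)).congr_deriv ?_
    rw [one_mul]
    exact hL.dirDeriv_angularHessian_flow hR hcirc _ s
  have := is_const_of_deriv_eq_zero (fun s => (hd s).differentiableAt) (fun s => (hd s).deriv)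
    (φ - Real.pi / 2) 0
  simpa [Real.sin_sub_pi_div_two, Real.cos_sub_pi_div_two, c₁, c₂] using this

/-- Variation of constants for `ℓ + ℓ'' = angularHessian L`. -/
theorem integral_cos_mul_angularHessian (hL : IsHomogeneousLagrangian L) (x : ℝ × ℝ)
    (α p q : ℝ) :
    ∫ φ in p..q, Real.cos (α - φ) * angularHessian L (x, φ - Real.pi / 2)
      = (dirDeriv (0, 1) (angular L) (x, q - Real.pi / 2) * Real.cos (α - q)
          - angular L (x, q - Real.pi / 2) * Real.sin (α - q))
        - (dirDeriv (0, 1) (angular L) (x, p - Real.pi / 2) * Real.cos (α - p)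
          - angular L (x, p - Real.pi / 2) * Real.sin (α - p)) := by
  have hcont := hL.contDiff_angularHessian.continuous
  have hshift : ∀ {f : (ℝ × ℝ) × ℝ → ℝ}, ContDiff ℝ ∞ f → ∀ φ : ℝ,
      HasDerivAt (fun φ => f (x, φ - Real.pi / 2))
        (dirDeriv (0, 1) f (x, φ - Real.pi / 2)) φ := fun {f} hf φ => by
    simpa [Function.comp_def] using HasDerivAt.comp (h₂ := fun s => f (x, s)) φ
      (hasDerivAt_angle hf x (φ - Real.pi / 2)) ((hasDerivAt_id φ).sub_const (Real.pi / 2))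
  refine intervalIntegral.integral_eq_sub_of_hasDerivAt (f := fun φ =>
    dirDeriv (0, 1) (angular L) (x, φ - Real.pi / 2) * Real.cos (α - φ)
      - angular L (x, φ - Real.pi / 2) * Real.sin (α - φ)) (fun φ _ => ?_)
    (Continuous.intervalIntegrable (by fun_prop) _ _)
  have hα := (hasDerivAt_id φ).const_sub α
  refine (((hshift (hL.contDiff_angular.dirDeriv (0, 1)) φ).mul hα.cos).sub
    ((hshift hL.contDiff_angular φ).mul hα.sin)).congr_deriv ?_
  simp only [angularHessian, id]
  ring

end IsHomogeneousLagrangian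

/-! ### Center of mass and conclusion -/

/-- A positive density on a circle whose first Fourier coefficients vanish has its center of mass
at the center of the circle. -/
theorem circleCenterOfMass_eq {g : ℝ × ℝ → ℝ} (hg : Continuous g) (hpos : ∀ y, 0 < g y) {R : ℝ}
    (hR : 0 < R) {c : ℝ × ℝ}
    (hcos : ∫ φ in (0 : ℝ)..(2 * Real.pi), Real.cos φ * g (circlePoint R c φ) = 0)
    (hsin : ∫ φ in (0 : ℝ)..(2 * Real.pi), Real.sin φ * g (circlePoint R c φ) = 0) :
    circleCenterOfMass g R c = c := by
  have hcirc : Continuous (circlePoint R c) := by unfold circlePoint; fun_prop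
  have hgc : Continuous fun φ => g (circlePoint R c φ) := hg.comp hcirc
  have hM : 0 < ∫ φ in (0 : ℝ)..(2 * Real.pi), g (circlePoint R c φ) * R :=
    intervalIntegral.intervalIntegral_pos_of_pos
      ((hgc.mul continuous_const).intervalIntegrable _ _)
      (fun φ => mul_pos (hpos _) hR) (by positivity)
  have hint : IntervalIntegrable (fun φ => (g (circlePoint R c φ) * R) • circlePoint R c φ)
      volume 0 (2 * Real.pi) :=
    ((hgc.mul continuous_const).smul hcirc).intervalIntegrable _ _
  have h1 := (ContinuousLinearMap.fst ℝ ℝ ℝ).intervalIntegral_comp_comm hint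
  have h2 := (ContinuousLinearMap.snd ℝ ℝ ℝ).intervalIntegral_comp_comm hint
  have key : ∀ (d : ℝ) (f : ℝ → ℝ), Continuous f →
      ∫ φ in (0 : ℝ)..(2 * Real.pi), f φ * g (circlePoint R c φ) = 0 →
      ∫ φ in (0 : ℝ)..(2 * Real.pi), (g (circlePoint R c φ) * R) * (d + R * f φ)
        = (∫ φ in (0 : ℝ)..(2 * Real.pi), g (circlePoint R c φ) * R) * d := by
    intro d f hf h
    have e : ∀ φ, (g (circlePoint R c φ) * R) * (d + R * f φ)
        = (g (circlePoint R c φ) * R) * d + R ^ 2 * (f φ * g (circlePoint R c φ)) :=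
      fun φ => by ring
    simp only [e]
    rw [intervalIntegral.integral_add (Continuous.intervalIntegrable (by fun_prop) _ _)
      (Continuous.intervalIntegrable (by fun_prop) _ _), intervalIntegral.integral_mul_const,
      intervalIntegral.integral_const_mul, h, mul_zero, add_zero]
  have k1 := key c.1 Real.cos Real.continuous_cos hcos
  have k2 := key c.2 Real.sin Real.continuous_sin hsin
  simp only [ContinuousLinearMap.coe_fst', ContinuousLinearMap.coe_snd', Prod.smul_fst,
    Prod.smul_snd, smul_eq_mul, circlePoint] at h1 h2
  simp only [circlePoint] at k1 k2 hM
  rw [circleCenterOfMass]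
  refine Prod.ext ?_ ?_
  · simp only [Prod.smul_fst, smul_eq_mul, circlePoint]
    rw [← h1, k1, ← mul_assoc, inv_mul_cancel₀ hM.ne', one_mul]
  · simp only [Prod.smul_snd, smul_eq_mul, circlePoint]
    rw [← h2, k2, ← mul_assoc, inv_mul_cancel₀ hM.ne', one_mul]

theorem mainTheorem4 (R : ℝ) (hR : 0 < R) (L : ℝ × ℝ → ℝ × ℝ → ℝ)
    (hL : IsHomogeneousLagrangian L) (hcirc : ExtremalsArePositiveCircles L R) :
    ∃ g a b : ℝ × ℝ → ℝ,
      ContDiff ℝ ∞ g ∧ ContDiff ℝ ∞ a ∧ ContDiff ℝ ∞ b ∧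
      (∀ y : ℝ × ℝ, 0 < g y) ∧
      (∀ c : ℝ × ℝ, circleCenterOfMass g R c = c) ∧
      (∀ x₁ x₂ : ℝ,
        deriv (fun s : ℝ => a (x₁, s)) x₂ - deriv (fun s : ℝ => b (s, x₂)) x₁
          = 1 / R * g (x₁ + R, x₂)) ∧
      (∀ x₁ x₂ r α : ℝ, 0 ≤ r →
        L (x₁, x₂) (r * Real.cos α, r * Real.sin α)
          = r * ((∫ φ in (0 : ℝ)..(α + Real.pi / 2),
                Real.cos (α - φ) * g (x₁ + R * Real.cos φ, x₂ + R * Real.sin φ))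
              + a (x₁, x₂) * Real.cos α + b (x₁, x₂) * Real.sin α)) := by
  have hℓ := hL.contDiff_angular
  have hℓ' := hℓ.dirDeriv (0, 1)
  have hg : ContDiff ℝ ∞ (fun y : ℝ × ℝ => angularHessian L ((y.1, y.2 - R), 0)) :=
    hL.contDiff_angularHessian.comp (by fun_prop)
  -- `g y` is read off at the lowest point of the circle about `y`, where the direction is `0`. The
  -- lower limit `φ = 0` corresponds to direction `-π/2`, where `a` and `b` record the initial data
  -- of `ℓ`.
  refine ⟨fun y => angularHessian L ((y.1, y.2 - R), 0),
    fun x => dirDeriv (0, 1) (angular L) (x, -(Real.pi / 2)),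
    fun x => -angular L (x, -(Real.pi / 2)), hg, hℓ'.comp (by fun_prop),
    (hℓ.comp (by fun_prop)).neg, fun y => hL.angularHessian_pos _, fun c => ?_,
    fun x₁ x₂ => ?_, fun x₁ x₂ r α hr => ?_⟩
  -- Over a full period the boundary terms of the variation of constants cancel; `α = 0` and `α =
  -- π/2` give the cosine and sine coefficients.
  · have hperiod : ∀ α : ℝ, ∫ φ in (0 : ℝ)..(2 * Real.pi), Real.cos (α - φ)
        * angularHessian L (((circlePoint R c φ).1, (circlePoint R c φ).2 - R), 0) = 0 := by
      intro α
      have hp : ∀ β, angular L (c, β + 2 * Real.pi) = angular L (c, β) := fun β => by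
        simp [angular]
      have hp' : ∀ β, dirDeriv (0, 1) (angular L) (c, β + 2 * Real.pi)
          = dirDeriv (0, 1) (angular L) (c, β) := fun β => by
        have h := (hasDerivAt_angle hℓ c (β + 2 * Real.pi)).comp_add_const β (2 * Real.pi)
        simp only [hp] at h
        exact h.unique (hasDerivAt_angle hℓ c β)
      simp only [circlePoint, ← hL.angularHessian_circle hR hcirc]
      rw [hL.integral_cos_mul_angularHessian,
        show 2 * Real.pi - Real.pi / 2 = (0 - Real.pi / 2) + 2 * Real.pi by ring, hp, hp']
      simp
    refine circleCenterOfMass_eq hg.continuous (fun y => hL.angularHessian_pos _) hR ?_ ?_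
    · simpa using hperiod 0
    · simpa [Real.cos_pi_div_two_sub] using hperiod (Real.pi / 2)
  · have ha := (hasDerivAt_comp_curve hℓ' (hasDerivAt_const x₂ x₁) (hasDerivAt_id x₂)
      (hasDerivAt_const x₂ (-(Real.pi / 2)))).deriv
    have hb := (hasDerivAt_comp_curve hℓ (hasDerivAt_id x₁) (hasDerivAt_const x₁ x₂)
      (hasDerivAt_const x₁ (-(Real.pi / 2)))).neg.deriv
    have hEL := hL.euler_lagrange hR hcirc (x₁, x₂) (-(Real.pi / 2))
    have hm := hL.angularHessian_circle hR hcirc x₁ x₂ 0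
    simp only [id, zero_mul, one_mul, zero_add, add_zero] at ha hb
    simp only [zero_sub, Real.cos_zero, Real.sin_zero, mul_one, mul_zero, add_zero] at hm
    simp only [Real.cos_neg, Real.sin_neg, Real.cos_pi_div_two, Real.sin_pi_div_two] at hEL
    refine (congrArg₂ (· - ·) ha hb).trans ?_
    beta_reduce
    rw [← hm]
    field_simp
    linear_combination -hEL
  · have hformula : L (x₁, x₂) (Real.cos α, Real.sin α)
        = (∫ φ in (0 : ℝ)..(α + Real.pi / 2), Real.cos (α - φ)
            * angularHessian L ((x₁ + R * Real.cos φ, x₂ + R * Real.sin φ - R), 0))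
          + dirDeriv (0, 1) (angular L) ((x₁, x₂), -(Real.pi / 2)) * Real.cos α
          + -angular L ((x₁, x₂), -(Real.pi / 2)) * Real.sin α := by
      simp only [← hL.angularHessian_circle hR hcirc]
      rw [hL.integral_cos_mul_angularHessian]
      simp [angular]
      ring
    rcases hr.eq_or_lt with rfl | hr
    -- At zero velocity homogeneity reads `L x 0 = 2 * L x 0`.
    · have h0 := hL.homogeneous (x₁, x₂) 0 2 two_pos
      rw [smul_zero] at h0
      simp only [zero_mul]
      change L (x₁, x₂) 0 = 0
      linarith
    · rw [← hformula, ← hL.homogeneous _ _ r hr]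
      rfl
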